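/- Let $d\ge 1$ and let $\Omega\subset\mathbb{R}^d$ be an open, connected and bounded set with Lipschitz boundary. Let $\bar K\colon[0,+\infty)\to[0,+\infty)$ be a measurable function with $\int_0^{+\infty}\bar K(r)\,r^d\,\mathrm{d}r<+\infty$, put $K(h)=\bar K(|h|)$ for $h\in\mathbb{R}^d$, and suppose that $K$ is not zero almost everywhere. For $\varepsilon>0$ let $K_\varepsilon(h)=\varepsilon^{-d}K(h/\varepsilon)$ and, for a measurable set $E\subset\mathbb{R}^d$ with characteristic function $\chi_E$, let $$J^1_\varepsilon(E,\Omega)=\int_\Omega\int_\Omega K_\varepsilon(y-x)\,|\chi_E(y)-\chi_E(x)|\,\mathrm{d}y\,\mathrm{d}x .$$ A measurable set $E\subset\mathbb{R}^d$ has finite perimeter in $\Omega$ if $\chi_E\in L^1(\Omega)$ and the total variation of its distributional gradient on $\Omega$, $$|\mathrm{D}\chi_E|(\Omega)=\sup\Big\{\int_\Omega \chi_E\,\operatorname{div}\varphi\,\mathrm{d}x:\ \varphi\in C^1_c(\Omega;\mathbb{R}^d),\ |\varphi|\le 1\Big\},$$ is finite. Theorem (Compactness criterion). For every $n\in\mathbb{N}$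 let $\varepsilon_n>0$ and let $E_n\subset\Omega$ be measurable. If $\varepsilon_n\to0$ and the quantities $\frac{1}{\varepsilon_n}J^1_{\varepsilon_n}(E_n,\Omega)$ are uniformly bounded in $n$, then there exist a subsequence $(E_{n_k})_k$ and a set $E$ with finite perimeter in $\Omega$ such that $E_{n_k}\to E$ in $L^1(\Omega)$, that is, $\|\chi_{E_{n_k}}-\chi_E\|_{L^1(\Omega)}\to0$. -/

import Mathlib

open MeasureTheory Set Filter Topology
open scoped NNReal ENNReal

namespace NonlocalPerimeter

/-- `ℝᵈ` with the Euclidean norm and Lebesgue measure. -/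
abbrev Space (d : ℕ) : Type := EuclideanSpace ℝ (Fin d)

/-- The characteristic function `χ_E` of a set. -/
noncomputable def charFn {d : ℕ} (E : Set (Space d)) : Space d → ℝ :=
  E.indicator fun _ => 1

/-- The boundary of `Ω` is Lipschitz: near each of its points, in the coordinates `z + t e` with
`e` a unit vector and `z ⟂ e`, the set `Ω` is the strict subgraph `{t < g z}` of a Lipschitz
function `g`. -/
def HasLipschitzBoundary {d : ℕ} (Ω : Set (Space d)) : Prop :=
  ∀ p ∈ frontier Ω, ∃ (e : Space d) (V : Set (Space d)) (g : (Submodule.span ℝ {e})ᗮ → ℝ)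
    (L : ℝ≥0), ‖e‖ = 1 ∧ IsOpen V ∧ p ∈ V ∧ LipschitzWith L g ∧
      ∀ (z : (Submodule.span ℝ {e})ᗮ) (t : ℝ), (z : Space d) + t • e ∈ V →
        ((z : Space d) + t • e ∈ Ω ↔ t < g z)

/-- The radial kernel `K(h) = K̄(|h|)` with profile `K̄`. -/
noncomputable def radialKernel (d : ℕ) (Kbar : ℝ → ℝ) : Space d → ℝ :=
  fun h => Kbar ‖h‖

/-- The mass preserving rescaling `K_ε(h) = ε⁻ᵈ K(h / ε)`. -/
noncomputable def rescale {d : ℕ} (K : Space d → ℝ) (ε : ℝ) : Space d → ℝ :=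
  fun h => 1 / ε ^ d * K (ε⁻¹ • h)

/-- `J¹_K(u, Ω) = ∫_Ω ∫_Ω K(y - x) |u(y) - u(x)| dy dx`, as an element of `[0, ∞]`. -/
noncomputable def localEnergy {d : ℕ} (K : Space d → ℝ) (u : Space d → ℝ)
    (Ω : Set (Space d)) : ℝ≥0∞ :=
  ∫⁻ x in Ω, ∫⁻ y in Ω, ENNReal.ofReal (K (y - x) * |u y - u x|)

/-- The divergence `∑ᵢ ∂ᵢ φᵢ` of a vector field on `ℝᵈ`. -/
noncomputable def divergence {d : ℕ} (φ : Space d → Space d) (x : Space d) : ℝ :=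
  ∑ i : Fin d, (fderiv ℝ φ x (EuclideanSpace.single i 1)) i

/-- The total variation `|Du|(Ω)` of the distributional gradient of `u` on the open set `Ω`:
the supremum of `∫_Ω u div φ` over the `C¹` vector fields `φ` with compact support in `Ω` and
`|φ| ≤ 1`. It may be infinite. -/
noncomputable def totalVariation {d : ℕ} (u : Space d → ℝ) (Ω : Set (Space d)) : ℝ≥0∞ :=
  ⨆ (φ : Space d → Space d) (_ : ContDiff ℝ 1 φ ∧ HasCompactSupport φ ∧ tsupport φ ⊆ Ω ∧
      ∀ x, ‖φ x‖ ≤ 1),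
    ENNReal.ofReal (∫ x in Ω, u x * divergence φ x)

/-- `u ∈ BV(Ω)`: `u ∈ L¹(Ω)` and `|Du|(Ω) < ∞`. -/
def IsBV {d : ℕ} (u : Space d → ℝ) (Ω : Set (Space d)) : Prop :=
  IntegrableOn u Ω volume ∧ totalVariation u Ω < ∞

/-- `E` is Lebesgue measurable and has finite perimeter in `Ω`: `χ_E ∈ BV(Ω)`. -/
def HasFinitePerimeter {d : ℕ} (E Ω : Set (Space d)) : Prop :=
  NullMeasurableSet E volume ∧ IsBV (charFn E) Ω

/-- `E n → E` in `L¹(Ω)`, sets being identified with their characteristic functions. -/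
def TendstoL1 {d : ℕ} (E : ℕ → Set (Space d)) (E₀ Ω : Set (Space d)) : Prop :=
  Tendsto (fun n => eLpNorm (charFn (E n) - charFn E₀) 1 (volume.restrict Ω)) atTop (𝓝 0)

end NonlocalPerimeter

/-! The defect `|E ∆ (E - h)|` of a set `E` is even and subadditive in `h`. On a compact set `A` of
positive measure where the kernel is at least `δ > 0`, the energy bound controls the average of the
defects of `E n` at the points `ε n • a`, `a ∈ A`; the Lipschitz boundary makes the defect of `Ω`
linear in `h`, which pays for the points that the translation moves out of `Ω`. For small `h` many
`a ∈ A` have `a + h ∈ A`, and averaging `h = (a + h) - a` over them bounds every defect at scale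
`ε n`. Subadditivity then extends the bound to all `h`, in the form `M (|h| + ε n)`.

As `ε n → 0` this is equicontinuity in `L¹`, so that averages of `χ_{E n}` over a fixed small
neighbourhood of each point are close to `χ_{E n}`, while they converge along a weakly convergent
subsequence. The limit has defect at most `M |h|`, hence finite perimeter, as difference quotients
of test fields show. -/

namespace NonlocalPerimeter

open scoped symmDiff

section TranslationDefect

variable {G : Type*} [AddGroup G] [MeasurableSpace G] {μ : Measure G} {E F : Set G}

/-- The measure of `E ∆ (E - h)`, that is, the `L¹` norm of `χ_E(· + h) - χ_E`. A set has finite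
perimeter if this grows at most linearly in `h`. -/
noncomputable def translationDefect (μ : Measure G) (E : Set G) (h : G) : ℝ≥0∞ :=
  μ (E ∆ ((· + h) ⁻¹' E))

section Invariant

variable [MeasurableAdd G] [μ.IsAddRightInvariant]

theorem translationDefect_neg (E : Set G) (h : G) :
    translationDefect μ E (-h) = translationDefect μ E h := by
  rw [translationDefect, ← measure_preimage_add_right μ h, preimage_symmDiff, ← preimage_comp,
    symmDiff_comm]
  simp [Function.comp_def, translationDefect]

theorem translationDefect_add_le (E : Set G) (h k : G) :
    translationDefect μ E (h + k) ≤ translationDefect μ E h + translationDefect μ E k := by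
  have shifted : translationDefect μ E k =
      μ (((· + h) ⁻¹' E) ∆ ((· + (h + k)) ⁻¹' E)) := by
    rw [translationDefect, ← measure_preimage_add_right μ h, preimage_symmDiff, ← preimage_comp]
    simp only [Function.comp_def, add_assoc]
  rw [shifted]
  exact measure_symmDiff_le _ _ _

theorem translationDefect_le_add_two_mul (E F : Set G) (h : G) :
    translationDefect μ F h ≤ translationDefect μ E h + 2 * μ (E ∆ F) :=
  calc μ (F ∆ ((· + h) ⁻¹' F))
      ≤ μ (F ∆ E) + μ (E ∆ ((· + h) ⁻¹' E)) + μ (((· + h) ⁻¹' E) ∆ ((· + h) ⁻¹' F)) :=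
        (measure_symmDiff_le _ _ _).trans <| (add_le_add_right (measure_symmDiff_le _ _ _) _).trans
          (add_assoc _ _ _).ge
    _ = translationDefect μ E h + 2 * μ (E ∆ F) := by
        rw [← preimage_symmDiff, measure_preimage_add_right, symmDiff_comm F, translationDefect]
        ring

theorem translationDefect_le_of_tendsto {ι : Type*} {l : Filter ι} [l.NeBot] {E : ι → Set G}
    {F : Set G} {h : G} {b : ι → ℝ≥0∞} {c : ℝ≥0∞} (hE : ∀ i, translationDefect μ (E i) h ≤ b i)
    (hb : Tendsto b l (𝓝 c)) (hF : Tendsto (fun i => μ (E i ∆ F)) l (𝓝 0)) :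
    translationDefect μ F h ≤ c := by
  have bound_tendsto : Tendsto (fun i => b i + 2 * μ (E i ∆ F)) l (𝓝 (c + 2 * 0)) :=
    hb.add (ENNReal.Tendsto.const_mul hF (.inr ENNReal.ofNat_ne_top))
  rw [mul_zero, add_zero] at bound_tendsto
  exact ge_of_tendsto' bound_tendsto fun i =>
    (translationDefect_le_add_two_mul (E i) F h).trans (by gcongr; exact hE i)

end Invariant

theorem measurable_translationDefect [MeasurableAdd₂ G] [SFinite μ] (hE : MeasurableSet E) :
    Measurable (translationDefect μ E) := by
  have shift : MeasurableSet {p : G × G | p.2 + p.1 ∈ E} :=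
    (measurable_snd.add measurable_fst) hE
  exact measurable_measure_prodMk_left ((measurable_snd hE).symmDiff shift)

theorem tendsto_translationDefect_zero [TopologicalSpace G] [IsTopologicalAddGroup G] [BorelSpace G]
    [μ.IsAddRightInvariant] [μ.InnerRegularCompactLTTop] [IsLocallyFiniteMeasure μ]
    (hE : NullMeasurableSet E μ) (hfin : μ E ≠ ∞) :
    Tendsto (translationDefect μ E) (𝓝 0) (𝓝 0) := by
  have translations : Tendsto (fun h : G => (⟨(· + h), by fun_prop⟩ : C(G, G))) (𝓝 0)
      (𝓝 ⟨(· + 0), by fun_prop⟩) :=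
    (ContinuousMap.continuous_of_continuous_uncurry _
      (continuous_snd.add continuous_fst)).tendsto 0
  have tendsto_shift := tendsto_measure_symmDiff_preimage_nhds_zero translations
    (.of_forall fun h => measurePreserving_add_right μ h) (measurePreserving_add_right μ 0) hE hfin
  refine (tendsto_shift.congr fun h => ?_)
  rw [translationDefect, symmDiff_comm]
  simp

end TranslationDefect

section Subadditive

theorem apply_nsmul_le_of_subadditive {M : Type*} [AddCommMonoid M] {f : M → ℝ≥0∞}
    (hf : ∀ x y, f (x + y) ≤ f x + f y) {n : ℕ} (hn : n ≠ 0) (x : M) : f (n • x) ≤ n * f x := by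
  simpa using Finset.le_sum_nonempty_of_subadditive f hf (Finset.nonempty_range_iff.2 hn)
    fun _ => x

variable {E : Type*} [SeminormedAddCommGroup E] [NormedSpace ℝ E] {f : E → ℝ≥0∞}

theorem le_ofReal_mul_of_subadditive (hf : ∀ x y, f (x + y) ≤ f x + f y) {ρ : ℝ} (hρ : 0 < ρ)
    {B : ℝ≥0∞} (hB : ∀ x, ‖x‖ ≤ ρ → f x ≤ B) (x : E) : f x ≤ ENNReal.ofReal (‖x‖ / ρ + 1) * B := by
  set n : ℕ := ⌊‖x‖ / ρ⌋₊ + 1 with hn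
  have n_pos : (0 : ℝ) < n := by positivity
  have n_gt : ‖x‖ / ρ < n := by simpa [hn] using Nat.lt_floor_add_one (‖x‖ / ρ)
  have n_le : (n : ℝ) ≤ ‖x‖ / ρ + 1 := by
    simpa [hn] using Nat.floor_le (div_nonneg (norm_nonneg x) hρ.le)
  have norm_le : ‖(n : ℝ)⁻¹ • x‖ ≤ ρ := by
    rw [norm_smul, norm_inv, Real.norm_natCast, inv_mul_le_iff₀ n_pos, ← div_le_iff₀ hρ]
    exact n_gt.le
  calc f x = f (n • (n : ℝ)⁻¹ • x) := by
        rw [← Nat.cast_smul_eq_nsmul ℝ, smul_inv_smul₀ n_pos.ne']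
    _ ≤ n * f ((n : ℝ)⁻¹ • x) := apply_nsmul_le_of_subadditive hf (by simp [hn]) _
    _ ≤ ENNReal.ofReal (‖x‖ / ρ + 1) * B := by
        gcongr
        · simpa using ENNReal.ofReal_le_ofReal n_le
        · exact hB _ norm_le

theorem le_mul_enorm_of_subadditive_of_eventually (hf : ∀ x y, f (x + y) ≤ f x + f y) {C : ℝ≥0∞}
    (hC : ∀ᶠ x in 𝓝 0, f x ≤ C * ‖x‖ₑ) (x : E) : f x ≤ C * ‖x‖ₑ := by
  have small_multiples : Tendsto (fun n : ℕ => (n : ℝ)⁻¹ • x) atTop (𝓝 0) := by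
    simpa using (tendsto_inv_atTop_nhds_zero_nat (𝕜 := ℝ)).smul_const x
  obtain ⟨n, hn, n_ne⟩ :=
    ((small_multiples.eventually hC).and (eventually_ne_atTop 0)).exists
  have n_ne' : (n : ℝ) ≠ 0 := Nat.cast_ne_zero.2 n_ne
  have x_eq : n • (n : ℝ)⁻¹ • x = x := by rw [← Nat.cast_smul_eq_nsmul ℝ, smul_inv_smul₀ n_ne']
  calc f x = f (n • (n : ℝ)⁻¹ • x) := by rw [x_eq]
    _ ≤ n * (C * ‖(n : ℝ)⁻¹ • x‖ₑ) := (apply_nsmul_le_of_subadditive hf n_ne _).trans (by gcongr)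
    _ = C * ‖n • (n : ℝ)⁻¹ • x‖ₑ := by
        rw [← Nat.cast_smul_eq_nsmul ℝ, enorm_smul (n : ℝ), mul_left_comm]
        simp
    _ = C * ‖x‖ₑ := by rw [x_eq]

end Subadditive

section Averaging

variable {G : Type*} [AddGroup G] [MeasurableSpace G] {μ : Measure G} {A : Set G}

theorem measure_inter_translate_mul_le [MeasurableAdd G] [μ.IsAddRightInvariant] {f : G → ℝ≥0∞}
    (f_meas : Measurable f) (f_neg : ∀ x, f (-x) = f x) (f_add : ∀ x y, f (x + y) ≤ f x + f y)
    (hA : MeasurableSet A) (h : G) :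
    μ (A ∩ (· + h) ⁻¹' A) * f h ≤ 2 * ∫⁻ a in A, f a ∂μ := by
  -- Average `h = (a + h) - a` over the points `a` of `A` with `a + h ∈ A`.
  have shifted : ∫⁻ a in (· + h) ⁻¹' A, f (a + h) ∂μ = ∫⁻ a in A, f a ∂μ :=
    (measurePreserving_add_right μ h).setLIntegral_comp_preimage hA f_meas
  calc μ (A ∩ (· + h) ⁻¹' A) * f h
      = ∫⁻ _ in A ∩ (· + h) ⁻¹' A, f h ∂μ := by rw [setLIntegral_const, mul_comm]
    _ ≤ ∫⁻ a in A ∩ (· + h) ⁻¹' A, (f a + f (a + h)) ∂μ :=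
        lintegral_mono fun a => by simpa [f_neg] using f_add (-a) (a + h)
    _ = ∫⁻ a in A ∩ (· + h) ⁻¹' A, f a ∂μ + ∫⁻ a in A ∩ (· + h) ⁻¹' A, f (a + h) ∂μ :=
        lintegral_add_left f_meas _
    _ ≤ ∫⁻ a in A, f a ∂μ + ∫⁻ a in (· + h) ⁻¹' A, f (a + h) ∂μ :=
        add_le_add (lintegral_mono_set inter_subset_left) (lintegral_mono_set inter_subset_right)
    _ = 2 * ∫⁻ a in A, f a ∂μ := by rw [shifted, two_mul]

theorem measure_le_add_translationDefect (A : Set G) (h : G) :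
    μ A ≤ μ (A ∩ (· + h) ⁻¹' A) + translationDefect μ A h := by
  refine (measure_mono fun x hx => ?_).trans (measure_union_le _ _)
  by_cases hxh : x + h ∈ A
  exacts [Or.inl ⟨hx, hxh⟩, Or.inr (Or.inl ⟨hx, hxh⟩)]

theorem eventually_measure_half_le_inter_translate [TopologicalSpace G] [IsTopologicalAddGroup G]
    [BorelSpace G] [μ.IsAddRightInvariant] [μ.InnerRegularCompactLTTop] [IsLocallyFiniteMeasure μ]
    (hA : NullMeasurableSet A μ) (hA0 : μ A ≠ 0) (hfin : μ A ≠ ∞) :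
    ∀ᶠ h in 𝓝 0, μ A / 2 ≤ μ (A ∩ (· + h) ⁻¹' A) := by
  have half_pos : 0 < μ A / 2 := ENNReal.half_pos hA0
  filter_upwards [(tendsto_translationDefect_zero hA hfin).eventually_lt_const half_pos] with h hh
  refine ENNReal.le_of_add_le_add_right (ENNReal.div_ne_top hfin two_ne_zero) ?_
  calc μ A / 2 + μ A / 2 = μ A := ENNReal.add_halves _
    _ ≤ μ (A ∩ (· + h) ⁻¹' A) + translationDefect μ A h := measure_le_add_translationDefect A h
    _ ≤ μ (A ∩ (· + h) ⁻¹' A) + μ A / 2 := by gcongr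

theorem exists_forall_le_mul_setLIntegral {E : Type*} [NormedAddCommGroup E] [NormedSpace ℝ E]
    [MeasurableSpace E] [BorelSpace E] {μ : Measure E} [μ.IsAddRightInvariant]
    [μ.InnerRegularCompactLTTop] [IsLocallyFiniteMeasure μ] {A : Set E} (hA : MeasurableSet A)
    (hA0 : μ A ≠ 0) (hfin : μ A ≠ ∞) :
    ∃ c : ℝ≥0, ∀ f : E → ℝ≥0∞, Measurable f → (∀ x, f (-x) = f x) →
      (∀ x y, f (x + y) ≤ f x + f y) →
        ∀ x, f x ≤ c * ENNReal.ofReal (‖x‖ + 1) * ∫⁻ a in A, f a ∂μ := by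
  obtain ⟨r, r_pos, overlap⟩ := Metric.nhds_basis_closedBall.eventually_iff.1
    (eventually_measure_half_le_inter_translate hA.nullMeasurableSet hA0 hfin)
  have half_ne_zero : μ A / 2 ≠ 0 := (ENNReal.half_pos hA0).ne'
  have half_ne_top : μ A / 2 ≠ ∞ := ENNReal.div_ne_top hfin two_ne_zero
  refine ⟨(1 / r + 1).toNNReal * ((μ A / 2)⁻¹ * 2).toNNReal, fun f f_meas f_neg f_add x => ?_⟩
  rw [ENNReal.coe_mul, ENNReal.coe_toNNReal (by finiteness)]
  have near_zero (y : E) (hy : ‖y‖ ≤ r) : f y ≤ (μ A / 2)⁻¹ * (2 * ∫⁻ a in A, f a ∂μ) := by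
    rw [← ENNReal.mul_le_iff_le_inv half_ne_zero half_ne_top]
    calc μ A / 2 * f y ≤ μ (A ∩ (· + y) ⁻¹' A) * f y := by
          gcongr
          exact overlap (mem_closedBall_zero_iff.2 hy)
      _ ≤ 2 * ∫⁻ a in A, f a ∂μ := measure_inter_translate_mul_le f_meas f_neg f_add hA y
  have ratio_le : ‖x‖ / r + 1 ≤ (1 / r + 1) * (‖x‖ + 1) := by
    have : 0 ≤ 1 / r + ‖x‖ := by positivity
    linarith [show (1 / r + 1) * (‖x‖ + 1) = ‖x‖ / r + 1 + (1 / r + ‖x‖) by ring]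
  calc f x ≤ ENNReal.ofReal (‖x‖ / r + 1) * ((μ A / 2)⁻¹ * (2 * ∫⁻ a in A, f a ∂μ)) :=
        le_ofReal_mul_of_subadditive f_add r_pos near_zero x
    _ ≤ ENNReal.ofReal ((1 / r + 1) * (‖x‖ + 1)) * ((μ A / 2)⁻¹ * (2 * ∫⁻ a in A, f a ∂μ)) := by
        gcongr
    _ = ENNReal.ofReal (1 / r + 1) * ((μ A / 2)⁻¹ * 2) * ENNReal.ofReal (‖x‖ + 1) *
          ∫⁻ a in A, f a ∂μ := by
        rw [ENNReal.ofReal_mul (by positivity)]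
        ring

end Averaging

theorem lintegral_measure_prodMk_comm {X Y : Type*} [MeasurableSpace X] [MeasurableSpace Y]
    {μ : Measure X} {ν : Measure Y} [SFinite μ] [SFinite ν] {S : Set (X × Y)}
    (hS : MeasurableSet S) : ∫⁻ x, ν {y | (x, y) ∈ S} ∂μ = ∫⁻ y, μ {x | (x, y) ∈ S} ∂ν :=
  (Measure.prod_apply hS).symm.trans (Measure.prod_apply_symm hS)

section LipschitzBoundary

section Strip

variable {E : Type*} [NormedAddCommGroup E] [NormedSpace ℝ E] [MeasurableSpace E] [BorelSpace E]
  [SecondCountableTopology E] {μ : Measure E} [μ.IsAddRightInvariant] [SFinite μ]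

theorem measure_le_mul_of_forall_volume_line_le {S B : Set E} (hS : MeasurableSet S) (v : E)
    {c : ℝ≥0∞} (hc : ∀ x, volume {t : ℝ | x + t • v ∈ S} ≤ c)
    (hB : ∀ x, ∀ t ∈ Icc (0 : ℝ) 1, x + t • v ∈ S → x ∈ B) : μ S ≤ c * μ B := by
  set ν : Measure ℝ := volume.restrict (Icc 0 1)
  have swept_meas : MeasurableSet {p : E × ℝ | p.1 + p.2 • v ∈ S} :=
    (measurable_fst.add (measurable_snd.smul_const v)) hS
  have section_le (x : E) : ν {t | x + t • v ∈ S} ≤ B.indicator (fun _ => c) x := by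
    by_cases hx : x ∈ B
    · rw [indicator_of_mem hx]
      exact (Measure.restrict_apply_le _ _).trans (hc x)
    · rw [indicator_of_notMem hx, Measure.restrict_apply' measurableSet_Icc,
        show {t : ℝ | x + t • v ∈ S} ∩ Icc 0 1 = ∅ from
          eq_empty_of_forall_notMem fun t ht => hx (hB x t ht.2 ht.1), measure_empty]
  calc μ S = ∫⁻ t : ℝ, μ ((· + t • v) ⁻¹' S) ∂ν := by simp [measure_preimage_add_right, ν]
    _ = ∫⁻ x, ν {t | x + t • v ∈ S} ∂μ :=
        (lintegral_measure_prodMk_comm swept_meas).symm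
    _ ≤ ∫⁻ x, B.indicator (fun _ => c) x ∂μ := lintegral_mono section_le
    _ ≤ c * μ B := lintegral_indicator_const_le B c

theorem measure_ball_inter_abs_le_le {G : E → ℝ} (hG : Measurable G) {e : E}
    (hGe : ∀ x t, G (x + t • e) = G x + t) (p : E) (r δ : ℝ) :
    μ (Metric.ball p r ∩ {x | |G x| ≤ δ}) ≤
      ENNReal.ofReal (2 * δ) * μ (Metric.ball p (r + ‖e‖)) := by
  refine measure_le_mul_of_forall_volume_line_le (Metric.isOpen_ball.measurableSet.inter
    (measurableSet_le hG.abs measurable_const)) e (fun x => ?_) fun x t ht hx => ?_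
  · calc volume {t : ℝ | x + t • e ∈ Metric.ball p r ∩ {x | |G x| ≤ δ}}
        ≤ volume (Icc (-G x - δ) (-G x + δ)) := measure_mono fun t ht => by
          have : |G x + t| ≤ δ := hGe x t ▸ ht.2.out
          constructor <;> linarith [abs_le.1 this]
      _ = ENNReal.ofReal (2 * δ) := by rw [Real.volume_Icc]; ring_nf
  · have dist_shift : dist x (x + t • e) ≤ ‖e‖ := by
      rw [dist_self_add_right, norm_smul, Real.norm_of_nonneg ht.1]
      exact mul_le_of_le_one_left (norm_nonneg e) ht.2
    have := Metric.mem_ball.1 hx.1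
    exact Metric.mem_ball.2 (by linarith [dist_triangle x (x + t • e) p])

theorem exists_measure_inter_symmDiff_translate_le [ProperSpace E] [IsFiniteMeasureOnCompacts μ]
    {Ω : Set E} {p e : E} {G : E → ℝ} {L : ℝ≥0} (hG : LipschitzWith L G)
    (hGe : ∀ x t, G (x + t • e) = G x + t) (hΩ : ∀ᶠ x in 𝓝 p, (x ∈ Ω ↔ G x < 0)) :
    ∃ U ∈ 𝓝 p, ∃ C : ℝ≥0, ∀ᶠ h in 𝓝 0, μ (U ∩ Ω ∆ ((· + h) ⁻¹' Ω)) ≤ C * ‖h‖ₑ := by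
  obtain ⟨r, r_pos, hr⟩ := Metric.eventually_nhds_iff_ball.1 hΩ
  refine ⟨Metric.ball p (r / 2), Metric.ball_mem_nhds p (half_pos r_pos),
    2 * L * (μ (Metric.ball p (r / 2 + ‖e‖))).toNNReal, ?_⟩
  filter_upwards [Metric.ball_mem_nhds (0 : E) (half_pos r_pos)] with h hh
  -- If exactly one of `x` and `x + h` lies in `Ω`, then `G` changes sign between them.
  have crossing_subset : Metric.ball p (r / 2) ∩ Ω ∆ ((· + h) ⁻¹' Ω) ⊆
      Metric.ball p (r / 2) ∩ {x | |G x| ≤ L * ‖h‖} := by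
    rintro x ⟨hx, x_crosses⟩
    have hxh : x + h ∈ Metric.ball p r := by
      rw [Metric.mem_ball] at hx ⊢
      linarith [dist_triangle (x + h) x p, dist_self_add_left h x, mem_ball_zero_iff.1 hh]
    have hx' := hr x (Metric.ball_subset_ball (half_le_self r_pos.le) hx)
    have variation : |G (x + h) - G x| ≤ L * ‖h‖ := by
      simpa [Real.dist_eq] using hG.dist_le_mul (x + h) x
    refine ⟨hx, ?_⟩
    rw [mem_symmDiff, mem_preimage, hr _ hxh, hx'] at x_crosses
    rw [mem_ofPred_eq, abs_le]
    rcases x_crosses with ⟨_, _⟩ | ⟨_, _⟩ <;> constructor <;> linarith [abs_le.1 variation]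
  calc μ (Metric.ball p (r / 2) ∩ Ω ∆ ((· + h) ⁻¹' Ω))
      ≤ ENNReal.ofReal (2 * (L * ‖h‖)) * μ (Metric.ball p (r / 2 + ‖e‖)) :=
        (measure_mono crossing_subset).trans
          (measure_ball_inter_abs_le_le hG.continuous.measurable hGe p _ _)
    _ = _ := by
        rw [ENNReal.coe_mul, ENNReal.coe_toNNReal measure_ball_lt_top.ne, ← mul_assoc,
          ENNReal.ofReal_mul (by positivity), ofReal_norm, ← NNReal.coe_ofNat, ← NNReal.coe_mul,
          ENNReal.ofReal_coe_nnreal, mul_right_comm]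

end Strip

theorem HasLipschitzBoundary.exists_lipschitz_level_function {d : ℕ} {Ω : Set (Space d)}
    (hΩ : HasLipschitzBoundary Ω) {p : Space d} (hp : p ∈ frontier Ω) :
    ∃ (e : Space d) (G : Space d → ℝ) (L : ℝ≥0), LipschitzWith L G ∧
      (∀ x t, G (x + t • e) = G x + t) ∧ ∀ᶠ x in 𝓝 p, (x ∈ Ω ↔ G x < 0) := by
  obtain ⟨e, V, g, L, he, hV, hpV, hg, chart⟩ := hΩ p hp
  set P := (Submodule.span ℝ {e})ᗮ.orthogonalProjectionOnto
  have P_e : P e = 0 := by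
    apply Submodule.orthogonalProjectionOnto_apply_of_mem_orthogonal
    rw [Submodule.orthogonal_orthogonal]
    exact Submodule.mem_span_singleton_self e
  have decompose (x : Space d) : (P x : Space d) + inner ℝ e x • e = x := by
    have := (Submodule.span ℝ {e}).starProjection_add_starProjection_orthogonal x
    rwa [Submodule.starProjection_unit_singleton ℝ he, add_comm] at this
  refine ⟨e, fun x => inner ℝ e x - g (P x), _,
    (innerSL ℝ e).lipschitz.sub (hg.comp P.lipschitz), fun x t => ?_, ?_⟩
  · simp only [map_add, map_smul, P_e, smul_zero, add_zero, inner_add_right, inner_smul_right,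
      real_inner_self_eq_norm_sq, he]
    ring
  · filter_upwards [hV.mem_nhds hpV] with x hx
    rw [sub_neg, ← chart (P x) (inner ℝ e x) (by rwa [decompose]), decompose]

theorem exists_mem_frontier_dist_le {E : Type*} [NormedAddCommGroup E] [NormedSpace ℝ E]
    [FiniteDimensional ℝ E] {s : Set E} {x y : E} (hx : x ∈ s) (hy : y ∉ s) :
    ∃ z ∈ frontier s, dist x z ≤ dist x y := by
  obtain ⟨z, hz, hxz⟩ := exists_mem_frontier_infDist_compl_eq_dist hx
    ((ne_univ_iff_exists_notMem s).2 ⟨y, hy⟩)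
  exact ⟨z, hz, hxz ▸ Metric.infDist_le_dist_of_mem hy⟩

theorem exists_mem_frontier_dist_le_of_mem_symmDiff {E : Type*} [NormedAddCommGroup E]
    [NormedSpace ℝ E] [FiniteDimensional ℝ E] {s : Set E} {x h : E}
    (hx : x ∈ s ∆ ((· + h) ⁻¹' s)) : ∃ z ∈ frontier s, dist x z ≤ ‖h‖ := by
  rw [← dist_self_add_right h x]
  rcases hx with ⟨hx, hxh⟩ | ⟨hxh, hx⟩
  · exact exists_mem_frontier_dist_le hx hxh
  · rw [← frontier_compl]
    exact exists_mem_frontier_dist_le hx (not_not.2 hxh)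

theorem HasLipschitzBoundary.exists_translationDefect_le {d : ℕ} {Ω : Set (Space d)}
    (hΩ : HasLipschitzBoundary Ω) (hΩ_bdd : Bornology.IsBounded Ω) :
    ∃ C : ℝ≥0, ∀ h, translationDefect volume Ω h ≤ C * ‖h‖ₑ := by
  have frontier_compact : IsCompact (frontier Ω) :=
    Metric.isCompact_of_isClosed_isBounded isClosed_frontier
      (hΩ_bdd.closure.subset frontier_subset_closure)
  obtain ⟨U, hU, C, near_frontier⟩ : ∃ U ∈ 𝓝ˢ (frontier Ω), ∃ C : ℝ≥0, ∀ᶠ h in 𝓝 0,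
      volume (U ∩ Ω ∆ ((· + h) ⁻¹' Ω)) ≤ C * ‖h‖ₑ := by
    refine frontier_compact.induction_on (p := fun S => ∃ U ∈ 𝓝ˢ S, ∃ C : ℝ≥0, ∀ᶠ h in 𝓝 0,
      volume (U ∩ Ω ∆ ((· + h) ⁻¹' Ω)) ≤ C * ‖h‖ₑ) ⟨∅, by simp, 0, by simp⟩ ?_ ?_ ?_
    · rintro S T hST ⟨U, hU, hU_le⟩
      exact ⟨U, nhdsSet_mono hST hU, hU_le⟩
    · rintro S T ⟨U, hU, C, hC⟩ ⟨U', hU', C', hC'⟩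
      refine ⟨U ∪ U', union_mem_nhdsSet hU hU', C + C', ?_⟩
      filter_upwards [hC, hC'] with h hh hh'
      rw [union_inter_distrib_right, ENNReal.coe_add, add_mul]
      exact (measure_union_le _ _).trans (add_le_add hh hh')
    · intro p hp
      obtain ⟨e, G, L, hG, hGe, hGΩ⟩ := hΩ.exists_lipschitz_level_function hp
      obtain ⟨U, hU, hU_le⟩ :=
        exists_measure_inter_symmDiff_translate_le (μ := volume) hG hGe hGΩ
      exact ⟨interior U, mem_nhdsWithin_of_mem_nhds (interior_mem_nhds.2 hU), U,
        mem_nhdsSet_interior, hU_le⟩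
  obtain ⟨δ, δ_pos, thickening_subset⟩ :=
    (Metric.hasBasis_nhdsSet_thickening frontier_compact).mem_iff.1 hU
  refine ⟨C, le_mul_enorm_of_subadditive_of_eventually (translationDefect_add_le Ω) ?_⟩
  filter_upwards [near_frontier, Metric.ball_mem_nhds 0 δ_pos] with h hh h_lt
  have crossing_subset : Ω ∆ ((· + h) ⁻¹' Ω) ⊆ U := fun x hx => by
    obtain ⟨z, hz, hxz⟩ := exists_mem_frontier_dist_le_of_mem_symmDiff hx
    exact thickening_subset
      (Metric.mem_thickening_iff.2 ⟨z, hz, hxz.trans_lt (mem_ball_zero_iff.1 h_lt)⟩)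
  rwa [inter_eq_right.2 crossing_subset] at hh

end LipschitzBoundary

section Kernel

theorem exists_isCompact_forall_le_of_not_ae_le_zero {X : Type*} [TopologicalSpace X]
    [MeasurableSpace X] {μ : Measure X} [μ.InnerRegular] {K : X → ℝ} (hK : AEMeasurable K μ)
    (hK_pos : ¬ K ≤ᵐ[μ] 0) :
    ∃ δ > 0, ∃ A, IsCompact A ∧ μ A ≠ 0 ∧ ∀ a ∈ A, δ ≤ K a := by
  obtain ⟨n, hn⟩ : ∃ n : ℕ, μ {x | 1 / ((n : ℝ) + 1) ≤ K x} ≠ 0 := by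
    by_contra! superlevel_null
    refine hK_pos (measure_mono_null (fun x hx => ?_) (measure_iUnion_null superlevel_null))
    obtain ⟨n, hn⟩ := exists_nat_one_div_lt (lt_of_not_ge (show ¬ K x ≤ 0 from hx))
    exact mem_iUnion_of_mem n hn.le
  obtain ⟨S, S_subset, S_meas, hS⟩ := (nullMeasurableSet_le
    (aemeasurable_const (b := 1 / ((n : ℝ) + 1))) hK).exists_measurable_subset_ae_eq
  obtain ⟨A, A_subset, A_compact, A_pos⟩ := S_meas.exists_lt_isCompact
    (pos_iff_ne_zero.2 (measure_congr hS ▸ hn))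
  exact ⟨_, Nat.one_div_pos_of_nat, A, A_compact, A_pos.ne', fun a ha => S_subset (A_subset ha)⟩

theorem quasiMeasurePreserving_norm {E : Type*} [NormedAddCommGroup E] [NormedSpace ℝ E]
    [FiniteDimensional ℝ E] [Nontrivial E] [MeasurableSpace E] [BorelSpace E] (μ : Measure E)
    [μ.IsAddHaarMeasure] :
    Measure.QuasiMeasurePreserving (norm : E → ℝ) μ (volume.restrict (Ici 0)) := by
  refine ⟨measurable_norm, Measure.AbsolutelyContinuous.mk fun N hN N_null => ?_⟩
  -- In polar coordinates, the integral of `χ ‖x‖` is a multiple of that of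
  -- `r ^ (dim E - 1) * χ r`.
  set χ : ℝ → ℝ := N.indicator 1
  have radial_null :
      (fun r => r ^ (Module.finrank ℝ E - 1) • χ r) =ᵐ[volume.restrict (Ioi 0)] 0 := by
    rw [← restrict_Ioi_eq_restrict_Ici] at N_null
    filter_upwards [measure_eq_zero_iff_ae_notMem.1 N_null] with r hr
    simp [χ, hr]
  have integrable : Integrable (fun x : E => χ ‖x‖) μ :=
    (integrable_fun_norm_addHaar μ).2 ((integrable_zero _ _ _).congr radial_null.symm)
  have integral_zero : ∫ x, χ ‖x‖ ∂μ = 0 := by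
    rw [integral_fun_norm_addHaar, integral_congr_ae radial_null]
    simp
  have χ_nonneg (r : ℝ) : 0 ≤ χ r := indicator_nonneg (fun _ _ => zero_le_one) r
  rw [Measure.map_apply measurable_norm hN, measure_eq_zero_iff_ae_notMem]
  filter_upwards [(integral_eq_zero_iff_of_nonneg (fun x => χ_nonneg ‖x‖) integrable).1
    integral_zero] with x hx
  simpa [χ] using hx

theorem aemeasurable_radialKernel {d : ℕ} (hd : 1 ≤ d) {Kbar : ℝ → ℝ}
    (hK : AEMeasurable Kbar (volume.restrict (Ici 0))) : AEMeasurable (radialKernel d Kbar) :=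
  have : Nonempty (Fin d) := ⟨⟨0, hd⟩⟩
  hK.comp_quasiMeasurePreserving (quasiMeasurePreserving_norm volume)

end Kernel

section Energy

theorem lintegral_comp_add_smul {E : Type*} [NormedAddCommGroup E] [NormedSpace ℝ E]
    [FiniteDimensional ℝ E] [MeasurableSpace E] [BorelSpace E] (μ : Measure E)
    [μ.IsAddHaarMeasure] (f : E → ℝ≥0∞) (x : E) {ε : ℝ} (hε : ε ≠ 0) :
    ∫⁻ h, f (x + ε • h) ∂μ =
      ENNReal.ofReal |(ε ^ Module.finrank ℝ E)⁻¹| * ∫⁻ y, f y ∂μ := by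
  rw [← lintegral_add_left_eq_self f x, ← smul_eq_mul, ← lintegral_smul_measure,
    ← Measure.map_addHaar_smul μ hε,
    (measurableEmbedding_const_smul₀ hε).lintegral_map (fun y => f (x + y))]

variable {d : ℕ} {Ω E A : Set (Space d)} {K : Space d → ℝ} {ε δ : ℝ}

theorem localEnergy_rescale (K u : Space d → ℝ) (hΩ : MeasurableSet Ω) (hε : 0 < ε) :
    localEnergy (rescale K ε) u Ω =
      ∫⁻ x in Ω, ∫⁻ h in {h | x + ε • h ∈ Ω}, ENNReal.ofReal (K h * |u (x + ε • h) - u x|) := by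
  refine lintegral_congr fun x => ?_
  have preimage_meas : MeasurableSet {h | x + ε • h ∈ Ω} :=
    (measurable_const_smul ε |>.const_add x) hΩ
  set f : Space d → ℝ≥0∞ := fun y => ENNReal.ofReal (K (ε⁻¹ • (y - x)) * |u y - u x|)
  have change_of_variables := lintegral_comp_add_smul volume (Ω.indicator f) x hε.ne'
  have jacobian : |(ε ^ Module.finrank ℝ (Space d))⁻¹| = 1 / ε ^ d := by
    rw [finrank_euclideanSpace_fin, abs_of_pos (by positivity), one_div]
  calc ∫⁻ y in Ω, ENNReal.ofReal (rescale K ε (y - x) * |u y - u x|)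
      = ENNReal.ofReal (1 / ε ^ d) * ∫⁻ y in Ω, f y := by
        rw [← lintegral_const_mul' _ _ ENNReal.ofReal_ne_top]
        refine lintegral_congr fun y => ?_
        rw [rescale, mul_assoc, ENNReal.ofReal_mul (by positivity)]
    _ = ∫⁻ h, Ω.indicator f (x + ε • h) := by
        rw [change_of_variables, jacobian, lintegral_indicator hΩ]
    _ = _ := by
        rw [← lintegral_indicator preimage_meas]
        refine lintegral_congr fun h => ?_
        simp [indicator, f, inv_smul_smul₀ hε.ne']

theorem ofReal_mul_lintegral_measure_crossing_le_localEnergy (hΩ : MeasurableSet Ω)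
    (hE : MeasurableSet E) (hA : MeasurableSet A) (hK : ∀ a ∈ A, δ ≤ K a) (hε : 0 < ε) :
    ENNReal.ofReal δ * ∫⁻ a in A, volume.restrict Ω
        ((· + ε • a) ⁻¹' Ω ∩ E ∆ ((· + ε • a) ⁻¹' E)) ≤
      localEnergy (rescale K ε) (charFn E) Ω := by
  set S : Set (Space d × Space d) :=
    {p | p.2 ∈ (· + ε • p.1) ⁻¹' Ω ∩ E ∆ ((· + ε • p.1) ⁻¹' E)}
  have shift_meas : Measurable fun p : Space d × Space d => p.2 + ε • p.1 := by fun_prop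
  have hS : MeasurableSet S :=
    (shift_meas hΩ).inter ((measurable_snd hE).symmDiff (shift_meas hE))
  have section_meas (x : Space d) : MeasurableSet {a | (a, x) ∈ S} := measurable_prodMk_right hS
  rw [show ∫⁻ a in A, volume.restrict Ω ((· + ε • a) ⁻¹' Ω ∩ E ∆ ((· + ε • a) ⁻¹' E)) = _ from
      lintegral_measure_prodMk_comm hS, localEnergy_rescale K _ hΩ hε,
    ← lintegral_const_mul' _ _ ENNReal.ofReal_ne_top]
  refine lintegral_mono fun x => ?_
  rw [Measure.restrict_apply (section_meas x), ← setLIntegral_const]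
  refine (setLIntegral_mono' ((section_meas x).inter hA) fun a ha =>
    ENNReal.ofReal_le_ofReal ?_).trans (lintegral_mono_set fun a ha => ha.1.1)
  have jump : |charFn E (x + ε • a) - charFn E x| = 1 := by
    rcases ha.1.2 with ⟨_, _⟩ | ⟨_, _⟩ <;> simp_all [charFn]
  rw [jump, mul_one]
  exact hK a ha.2

theorem ofReal_mul_lintegral_translationDefect_le (hΩ : MeasurableSet Ω) (hE : MeasurableSet E)
    (hEΩ : E ⊆ Ω) (hA : MeasurableSet A) (hK : ∀ a ∈ A, δ ≤ K a) (hε : 0 < ε) :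
    ENNReal.ofReal δ * ∫⁻ a in A, translationDefect volume E (ε • a) ≤
      localEnergy (rescale K ε) (charFn E) Ω +
        ENNReal.ofReal δ * ∫⁻ a in A, translationDefect volume Ω (ε • a) := by
  have split (h : Space d) : translationDefect volume E h ≤
      volume.restrict Ω ((· + h) ⁻¹' Ω ∩ E ∆ ((· + h) ⁻¹' E)) + translationDefect volume Ω h := by
    rw [Measure.restrict_apply' hΩ]
    refine (measure_mono fun x hx => ?_).trans (measure_union_le _ _)
    have := @hEΩ x
    have := @hEΩ (x + h)
    simp only [mem_symmDiff, mem_union, mem_inter_iff, mem_preimage] at hx ⊢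
    tauto
  have meas : Measurable fun a : Space d => translationDefect volume Ω (ε • a) :=
    (measurable_translationDefect hΩ).comp (measurable_const_smul ε)
  calc ENNReal.ofReal δ * ∫⁻ a in A, translationDefect volume E (ε • a)
      ≤ ENNReal.ofReal δ * ∫⁻ a in A,
          (volume.restrict Ω ((· + ε • a) ⁻¹' Ω ∩ E ∆ ((· + ε • a) ⁻¹' E)) +
            translationDefect volume Ω (ε • a)) := by
        gcongr with a
        exact split _
    _ = ENNReal.ofReal δ * (∫⁻ a in A,
          volume.restrict Ω ((· + ε • a) ⁻¹' Ω ∩ E ∆ ((· + ε • a) ⁻¹' E))) +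
            ENNReal.ofReal δ * ∫⁻ a in A, translationDefect volume Ω (ε • a) := by
        rw [lintegral_add_right _ meas, mul_add]
    _ ≤ _ := by
        gcongr
        exact ofReal_mul_lintegral_measure_crossing_le_localEnergy hΩ hE hA hK hε

theorem lintegral_translationDefect_smul_le {μ : Measure (Space d)} {CΩ : ℝ≥0∞} {R : ℝ}
    (hΩ : ∀ h, translationDefect μ Ω h ≤ CΩ * ‖h‖ₑ) (hA : MeasurableSet A)
    (hR : ∀ a ∈ A, ‖a‖ ≤ R) (hε : 0 ≤ ε) :
    ∫⁻ a in A, translationDefect μ Ω (ε • a) ∂μ ≤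
      ENNReal.ofReal ε * (CΩ * ENNReal.ofReal R * μ A) := by
  rw [← mul_assoc, ← setLIntegral_const]
  refine setLIntegral_mono' hA fun a ha => (hΩ _).trans ?_
  rw [enorm_smul, Real.enorm_of_nonneg hε, mul_left_comm, ← ofReal_norm a]
  gcongr
  exact hR a ha

theorem lintegral_translationDefect_smul_le_of_localEnergy_le {CΩ C : ℝ≥0∞} {R : ℝ}
    (hΩ : MeasurableSet Ω) (hΩ_le : ∀ h, translationDefect volume Ω h ≤ CΩ * ‖h‖ₑ)
    (hE : MeasurableSet E) (hEΩ : E ⊆ Ω) (hA : MeasurableSet A) (hR : ∀ a ∈ A, ‖a‖ ≤ R)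
    (hδ : 0 < δ) (hK : ∀ a ∈ A, δ ≤ K a) (hε : 0 < ε)
    (energy_le : ENNReal.ofReal (1 / ε) * localEnergy (rescale K ε) (charFn E) Ω ≤ C) :
    ∫⁻ a in A, translationDefect volume E (ε • a) ≤
      ENNReal.ofReal ε * (C / ENNReal.ofReal δ + CΩ * ENNReal.ofReal R * volume A) := by
  have δ_ne : ENNReal.ofReal δ ≠ 0 := (ENNReal.ofReal_pos.2 hδ).ne'
  have ε_ne : ENNReal.ofReal ε ≠ 0 := (ENNReal.ofReal_pos.2 hε).ne'
  have energy_le' : localEnergy (rescale K ε) (charFn E) Ω ≤ ENNReal.ofReal ε * C := by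
    rwa [one_div, ENNReal.ofReal_inv_of_pos hε,
      ENNReal.inv_mul_le_iff ε_ne ENNReal.ofReal_ne_top] at energy_le
  rw [← ENNReal.mul_le_mul_iff_right δ_ne ENNReal.ofReal_ne_top]
  calc ENNReal.ofReal δ * ∫⁻ a in A, translationDefect volume E (ε • a)
      ≤ localEnergy (rescale K ε) (charFn E) Ω +
          ENNReal.ofReal δ * ∫⁻ a in A, translationDefect volume Ω (ε • a) :=
        ofReal_mul_lintegral_translationDefect_le hΩ hE hEΩ hA hK hε
    _ ≤ ENNReal.ofReal ε * C +
          ENNReal.ofReal δ * (ENNReal.ofReal ε * (CΩ * ENNReal.ofReal R * volume A)) := by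
        gcongr
        exact lintegral_translationDefect_smul_le hΩ_le hA hR hε.le
    _ = ENNReal.ofReal δ * (ENNReal.ofReal ε *
          (C / ENNReal.ofReal δ + CΩ * ENNReal.ofReal R * volume A)) := by
        rw [mul_add, mul_add, mul_left_comm _ _ (C / _),
          ENNReal.mul_div_cancel δ_ne ENNReal.ofReal_ne_top]

theorem exists_forall_translationDefect_le {CΩ C : ℝ≥0} (hΩ : MeasurableSet Ω)
    (hΩ_le : ∀ h, translationDefect volume Ω h ≤ CΩ * ‖h‖ₑ) (hA : IsCompact A)
    (hA0 : volume A ≠ 0) (hδ : 0 < δ) (hK : ∀ a ∈ A, δ ≤ K a) :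
    ∃ M : ℝ≥0, ∀ ε > 0, ∀ E ⊆ Ω, MeasurableSet E →
      ENNReal.ofReal (1 / ε) * localEnergy (rescale K ε) (charFn E) Ω ≤ C →
        ∀ h, translationDefect volume E h ≤ M * ENNReal.ofReal (‖h‖ + ε) := by
  obtain ⟨R, hR⟩ := hA.isBounded.exists_norm_le
  obtain ⟨c, le_average⟩ :=
    exists_forall_le_mul_setLIntegral hA.measurableSet hA0 hA.measure_ne_top
  set avg : ℝ≥0∞ := C / ENNReal.ofReal δ + CΩ * ENNReal.ofReal R * volume A
  have avg_ne_top : avg ≠ ∞ := ENNReal.add_ne_top.2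
    ⟨ENNReal.div_ne_top ENNReal.coe_ne_top (ENNReal.ofReal_pos.2 hδ).ne', by
      have := hA.measure_ne_top (μ := volume)
      finiteness⟩
  refine ⟨c * avg.toNNReal, fun ε hε E hEΩ hE energy_le h => ?_⟩
  rw [ENNReal.coe_mul, ENNReal.coe_toNNReal avg_ne_top]
  set f : Space d → ℝ≥0∞ := fun x => translationDefect volume E (ε • x)
  have rescale_norm : (‖ε⁻¹ • h‖ + 1) * ε = ‖h‖ + ε := by
    rw [norm_smul, norm_inv, Real.norm_of_nonneg hε.le]
    field_simp
  calc translationDefect volume E h = f (ε⁻¹ • h) := by simp only [f, smul_inv_smul₀ hε.ne']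
    _ ≤ c * ENNReal.ofReal (‖ε⁻¹ • h‖ + 1) * ∫⁻ a in A, f a :=
        le_average f ((measurable_translationDefect hE).comp (measurable_const_smul ε))
          (fun x => by simp only [f, smul_neg, translationDefect_neg])
          (fun x y => by simpa only [f, smul_add] using translationDefect_add_le E _ _) _
    _ ≤ c * ENNReal.ofReal (‖ε⁻¹ • h‖ + 1) * (ENNReal.ofReal ε * avg) := by
        gcongr
        exact lintegral_translationDefect_smul_le_of_localEnergy_le hΩ hΩ_le hE hEΩ
          hA.measurableSet hR hδ hK hε energy_le
    _ = c * avg * ENNReal.ofReal (‖h‖ + ε) := by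
        rw [← rescale_norm, ENNReal.ofReal_mul (by positivity)]
        ring

theorem localEnergy_congr_ae {u v : Space d → ℝ} (K : Space d → ℝ) (huv : u =ᵐ[volume] v)
    (Ω : Set (Space d)) : localEnergy K u Ω = localEnergy K v Ω :=
  lintegral_congr_ae <| (ae_restrict_of_ae huv).mono fun x hx =>
    lintegral_congr_ae <| (ae_restrict_of_ae huv).mono fun y hy => by simp only [hx, hy]

end Energy

section Compactness

theorem exists_subseq_forall_tendsto_inner {H : Type*} [NormedAddCommGroup H]
    [InnerProductSpace ℝ H] [CompleteSpace H] [TopologicalSpace.SeparableSpace H] {u : ℕ → H}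
    {R : ℝ} (hu : ∀ n, ‖u n‖ ≤ R) :
    ∃ k : ℕ → ℕ, StrictMono k ∧
      ∀ w, ∃ l, Tendsto (fun n => inner ℝ (u (k n)) w) atTop (𝓝 l) := by
  obtain ⟨a, -, k, hk, tendsto_a⟩ := WeakDual.isSeqCompact_closedBall ℝ H 0 R
    (x := fun n => StrongDual.toWeakDual (InnerProductSpace.toDual ℝ H (u n)))
    (fun n => by simpa using hu n)
  exact ⟨k, hk, fun w => ⟨a w, ((WeakDual.eval_continuous w).tendsto a).comp tendsto_a⟩⟩

theorem exists_subseq_forall_tendsto_measureReal_inter {α : Type*} [MeasurableSpace α]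
    {μ : Measure α} [IsSeparable μ] {E : ℕ → Set α} (hE : ∀ n, MeasurableSet (E n)) {R : ℝ≥0}
    (hR : ∀ n, μ (E n) ≤ R) :
    ∃ k : ℕ → ℕ, StrictMono k ∧ ∀ B, MeasurableSet B → μ B ≠ ∞ →
      ∃ l, Tendsto (fun n => μ.real (E (k n) ∩ B)) atTop (𝓝 l) := by
  have : Fact ((2 : ℝ≥0∞) ≠ ∞) := ⟨ENNReal.ofNat_ne_top⟩
  have hfin (n) : μ (E n) ≠ ∞ := ne_top_of_le_ne_top ENNReal.coe_ne_top (hR n)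
  have norm_le (n) : ‖indicatorConstLp 2 (hE n) (hfin n) (1 : ℝ)‖ ≤
      (R : ℝ) ^ (1 / (2 : ℝ≥0∞).toReal) := by
    rw [norm_indicatorConstLp two_ne_zero ENNReal.ofNat_ne_top, norm_one, one_mul]
    exact Real.rpow_le_rpow measureReal_nonneg (ENNReal.toReal_le_coe_of_le_coe (hR n))
      (by positivity)
  obtain ⟨k, hk, weak⟩ := exists_subseq_forall_tendsto_inner norm_le
  refine ⟨k, hk, fun B hB hB_fin => ?_⟩
  obtain ⟨l, hl⟩ := weak (indicatorConstLp 2 hB hB_fin (1 : ℝ))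
  exact ⟨l, hl.congr fun n =>
    L2.real_inner_indicatorConstLp_one_indicatorConstLp_one (hE _) hB (hfin _) hB_fin⟩

theorem completeSpace_measuredSets {α : Type*} [MeasurableSpace α] (μ : Measure α) :
    CompleteSpace (MeasuredSets μ) := by
  obtain ⟨b, b_pos, sum_b⟩ := ENNReal.exists_pos_sum_of_countable' one_ne_zero ℕ
  refine EMetric.complete_of_convergent_controlled_sequences b b_pos fun u hu => ?_
  set limit : Set α := limsup (fun n => (u n : Set α)) atTop
  have limit_meas : MeasurableSet limit := .measurableSet_limsup fun n => (u n).2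
  have symmDiff_subset (N : ℕ) :
      (u N : Set α) ∆ limit ⊆ ⋃ n, (u (n + N) : Set α) ∆ u (n + 1 + N) := by
    intro x hx
    by_contra h
    have stationary : ∀ n ≥ N, (x ∈ (u n : Set α) ↔ x ∈ (u N : Set α)) := by
      refine Nat.le_induction Iff.rfl fun n hn ih => ?_
      obtain ⟨m, rfl⟩ := Nat.exists_eq_add_of_le' hn
      have not_mem := fun hm => h (mem_iUnion.2 ⟨m, hm⟩)
      rw [mem_symmDiff, add_right_comm] at not_mem
      tauto
    have mem_limit : x ∈ limit ↔ x ∈ (u N : Set α) := by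
      rw [mem_limsup_iff_frequently_mem,
        frequently_congr (eventually_atTop.2 ⟨N, stationary⟩), frequently_const]
    rw [mem_symmDiff] at hx
    tauto
  refine ⟨⟨limit, limit_meas⟩, tendsto_iff_edist_tendsto_0.2 ?_⟩
  have tail := ENNReal.tendsto_sum_nat_add b (ne_top_of_lt sum_b)
  refine tendsto_of_tendsto_of_tendsto_of_le_of_le tendsto_const_nhds tail (fun _ => zero_le)
    fun N => ?_
  calc μ ((u N : Set α) ∆ limit) ≤ ∑' n, μ ((u (n + N) : Set α) ∆ u (n + 1 + N)) :=
        (measure_mono (symmDiff_subset N)).trans (measure_iUnion_le _)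
    _ ≤ ∑' n, b (n + N) := ENNReal.tsum_le_tsum fun n => (hu _ _ _ le_rfl (by omega)).le

section LocalMass

variable {G : Type*} [AddGroup G] [MeasurableSpace G] {μ : Measure G} {B E F Ω : Set G}

/-- The measure of the part of `E` lying in the translate `x + B`; as a function of `x` it is a
mollification of `χ_E`, with unnormalized mollifier `χ_{-B}`. -/
noncomputable def localMass (μ : Measure G) (B E : Set G) (x : G) : ℝ :=
  μ.real (B ∩ (x + ·) ⁻¹' E)

theorem measurable_localMass [MeasurableAdd₂ G] [SFinite μ] (hB : MeasurableSet B)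
    (hE : MeasurableSet E) : Measurable (localMass μ B E) :=
  (measurable_measure_prodMk_left
    ((measurable_snd hB).inter ((measurable_fst.add measurable_snd) hE))).ennreal_toReal

theorem localMass_eq_measureReal_inter [MeasurableAdd G] [μ.IsAddLeftInvariant] (x : G) :
    localMass μ B E x = μ.real (E ∩ (-x + ·) ⁻¹' B) := by
  rw [localMass, measureReal_def, measureReal_def, ← measure_preimage_add μ x (E ∩ _),
    preimage_inter, ← preimage_comp, inter_comm]
  simp [Function.comp_def]

theorem edist_localMass_le_measure (hBfin : μ B ≠ ∞) (hE : E ⊆ Ω) (hF : F ⊆ Ω)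
    (x : G) : edist (localMass μ B E x) (localMass μ B F x) ≤ μ (B ∩ (x + ·) ⁻¹' Ω) := by
  have mass_le {E : Set G} (hE : E ⊆ Ω) : localMass μ B E x ≤ μ.real (B ∩ (x + ·) ⁻¹' Ω) :=
    measureReal_mono (by gcongr) (measure_ne_top_of_subset inter_subset_left hBfin)
  rw [← ofReal_measureReal (measure_ne_top_of_subset inter_subset_left hBfin),
    edist_le_ofReal measureReal_nonneg]
  exact abs_sub_le_of_nonneg_of_le measureReal_nonneg (mass_le hE) measureReal_nonneg (mass_le hF)

theorem lintegral_measure_inter_translate [MeasurableAdd₂ G] [SFinite μ] [μ.IsAddRightInvariant]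
    (hB : MeasurableSet B) (hΩ : MeasurableSet Ω) :
    ∫⁻ x, μ (B ∩ (x + ·) ⁻¹' Ω) ∂μ = μ B * μ Ω := by
  have sum_mem_meas : MeasurableSet {p : G × G | p.1 + p.2 ∈ Ω} :=
    (measurable_fst.add measurable_snd) hΩ
  calc ∫⁻ x, μ (B ∩ (x + ·) ⁻¹' Ω) ∂μ = ∫⁻ x, μ.restrict B {a | x + a ∈ Ω} ∂μ := by
        refine lintegral_congr fun x => ?_
        rw [Measure.restrict_apply' hB, inter_comm]
        rfl
    _ = ∫⁻ a in B, μ ((· + a) ⁻¹' Ω) ∂μ := lintegral_measure_prodMk_comm sum_mem_meas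
    _ = μ B * μ Ω := by simp [measure_preimage_add_right, mul_comm]

theorem measure_le_restrict_add_edist_localMass (hB : MeasurableSet B) (hBfin : μ B ≠ ∞) {x : G}
    (hx : x ∈ E ∆ F) :
    μ B ≤ μ.restrict B {a | x ∈ E ∆ ((· + a) ⁻¹' E)} + μ.restrict B {a | x ∈ F ∆ ((· + a) ⁻¹' F)} +
      edist (localMass μ B E x) (localMass μ B F x) := by
  have of_mem_of_notMem {E F : Set G} (hxE : x ∈ E) (hxF : x ∉ F) :
      μ B ≤ μ.restrict B {a | x ∈ E ∆ ((· + a) ⁻¹' E)} +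
        μ.restrict B {a | x ∈ F ∆ ((· + a) ⁻¹' F)} +
        edist (localMass μ B E x) (localMass μ B F x) := by
    have exit_mass : μ.restrict B {a | x ∈ E ∆ ((· + a) ⁻¹' E)} = μ (B \ (x + ·) ⁻¹' E) := by
      rw [Measure.restrict_apply' hB, inter_comm]
      congr 1
      ext a
      simp [mem_symmDiff, hxE]
    have mass_eq (E : Set G) : ENNReal.ofReal (localMass μ B E x) = μ (B ∩ (x + ·) ⁻¹' E) :=
      ofReal_measureReal (measure_ne_top_of_subset inter_subset_left hBfin)
    have entry_mass : μ.restrict B {a | x ∈ F ∆ ((· + a) ⁻¹' F)} =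
        ENNReal.ofReal (localMass μ B F x) := by
      rw [Measure.restrict_apply' hB, inter_comm, mass_eq]
      congr 1
      ext a
      simp [mem_symmDiff, hxF]
    have mass_le : ENNReal.ofReal (localMass μ B E x) ≤
        ENNReal.ofReal (localMass μ B F x) + edist (localMass μ B E x) (localMass μ B F x) := by
      rw [edist_dist, ← ENNReal.ofReal_add (by exact measureReal_nonneg) dist_nonneg]
      refine ENNReal.ofReal_le_ofReal ?_
      rw [← sub_le_iff_le_add']
      exact le_abs_self _
    rw [exit_mass, entry_mass, add_assoc]
    calc μ B ≤ μ (B ∩ (x + ·) ⁻¹' E) + μ (B \ (x + ·) ⁻¹' E) := measure_le_inter_add_sdiff _ _ _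
      _ ≤ _ := by rw [add_comm, ← mass_eq]; gcongr
  rcases hx with ⟨hxE, hxF⟩ | ⟨hxF, hxE⟩
  · exact of_mem_of_notMem hxE hxF
  · rw [edist_comm, add_comm (μ.restrict B _)]
    exact of_mem_of_notMem hxF hxE

theorem mul_measure_symmDiff_le [MeasurableAdd₂ G] [SFinite μ] (hB : MeasurableSet B)
    (hBfin : μ B ≠ ∞) (hE : MeasurableSet E) (hF : MeasurableSet F) :
    μ B * μ (E ∆ F) ≤ ∫⁻ a in B, translationDefect μ E a ∂μ +
      ∫⁻ a in B, translationDefect μ F a ∂μ +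
      ∫⁻ x, edist (localMass μ B E x) (localMass μ B F x) ∂μ := by
  have moved_meas {E : Set G} (hE : MeasurableSet E) :
      MeasurableSet {p : G × G | p.1 ∈ E ∆ ((· + p.2) ⁻¹' E)} :=
    (measurable_fst hE).symmDiff ((measurable_fst.add measurable_snd) hE)
  have fubini {E : Set G} (hE : MeasurableSet E) :
      ∫⁻ x, μ.restrict B {a | x ∈ E ∆ ((· + a) ⁻¹' E)} ∂μ = ∫⁻ a in B, translationDefect μ E a ∂μ :=
    lintegral_measure_prodMk_comm (moved_meas hE)
  have moved_measurable {E : Set G} (hE : MeasurableSet E) :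
      Measurable fun x => μ.restrict B {a | x ∈ E ∆ ((· + a) ⁻¹' E)} :=
    measurable_measure_prodMk_left (moved_meas hE)
  rw [← fubini hE, ← fubini hF, ← lintegral_add_left (moved_measurable hE),
    ← lintegral_add_left (by exact (moved_measurable hE).add (moved_measurable hF)),
    ← lintegral_indicator_const (hE.symmDiff hF)]
  exact lintegral_mono <| indicator_le fun x hx =>
    measure_le_restrict_add_edist_localMass hB hBfin hx

theorem tendsto_lintegral_edist_localMass [MeasurableAdd₂ G] [SFinite μ] [μ.IsAddLeftInvariant]
    [μ.IsAddRightInvariant] (hB : MeasurableSet B) (hBfin : μ B ≠ ∞) (hΩ : MeasurableSet Ω)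
    (hΩfin : μ Ω ≠ ∞) {E : ℕ → Set G} (hE : ∀ n, MeasurableSet (E n)) (hEΩ : ∀ n, E n ⊆ Ω)
    (weak : ∀ B, MeasurableSet B → μ B ≠ ∞ →
      ∃ l, Tendsto (fun n => μ.real (E n ∩ B)) atTop (𝓝 l)) :
    Tendsto (fun p : ℕ × ℕ =>
      ∫⁻ x, edist (localMass μ B (E p.1) x) (localMass μ B (E p.2) x) ∂μ) atTop (𝓝 0) := by
  have pointwise (x : G) : Tendsto (fun p : ℕ × ℕ =>
      edist (localMass μ B (E p.1) x) (localMass μ B (E p.2) x)) atTop (𝓝 0) := by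
    obtain ⟨l, hl⟩ := weak ((-x + ·) ⁻¹' B) (measurable_const_add _ hB)
      (by rwa [measure_preimage_add])
    simp only [← localMass_eq_measureReal_inter] at hl
    rw [← prod_atTop_atTop_eq, ← edist_self l]
    exact (hl.comp tendsto_fst).edist (hl.comp tendsto_snd)
  rw [← lintegral_zero (μ := μ)]
  refine tendsto_lintegral_filter_of_dominated_convergence (fun x => μ (B ∩ (x + ·) ⁻¹' Ω))
    (.of_forall fun p => (measurable_localMass hB (hE _)).edist (measurable_localMass hB (hE _)))
    (.of_forall fun p => .of_forall (edist_localMass_le_measure hBfin (hEΩ _) (hEΩ _))) ?_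
    (.of_forall pointwise)
  rw [lintegral_measure_inter_translate hB hΩ]
  exact ENNReal.mul_ne_top hBfin hΩfin

end LocalMass

section TopologicalGroup

variable {G : Type*} [AddCommGroup G] [TopologicalSpace G] [ContinuousAdd G]
  [SecondCountableTopology G] [MeasurableSpace G] [BorelSpace G] {μ : Measure G}
  [μ.IsAddLeftInvariant] [IsLocallyFiniteMeasure μ] [μ.IsOpenPosMeasure] {Ω : Set G} {E : ℕ → Set G}

theorem tendsto_measure_symmDiff_of_tendsto_translationDefect (hΩ : MeasurableSet Ω)
    (hΩfin : μ Ω ≠ ∞) (hE : ∀ n, MeasurableSet (E n)) (hEΩ : ∀ n, E n ⊆ Ω)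
    (hdefect : Tendsto (fun p : ℕ × G => translationDefect μ (E p.1) p.2) (atTop ×ˢ 𝓝 0) (𝓝 0))
    (weak : ∀ B, MeasurableSet B → μ B ≠ ∞ →
      ∃ l, Tendsto (fun n => μ.real (E n ∩ B)) atTop (𝓝 l)) :
    Tendsto (fun p : ℕ × ℕ => μ (E p.1 ∆ E p.2)) atTop (𝓝 0) := by
  refine ENNReal.tendsto_nhds_zero.2 fun η hη => ?_
  have third_pos : 0 < η / 3 := ENNReal.div_pos hη.ne' ENNReal.ofNat_ne_top
  obtain ⟨P, hP, Q, hQ, small⟩ := eventually_prod_iff.1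
    (ENNReal.tendsto_nhds_zero.1 hdefect _ third_pos)
  obtain ⟨U, hUQ, hU_open, h0U⟩ := eventually_nhds_iff.1 hQ
  obtain ⟨V, h0V, hV_open, hV_fin⟩ := μ.exists_isOpen_measure_lt_top 0
  set B := U ∩ V
  have hB_open : IsOpen B := hU_open.inter hV_open
  have hB0 : μ B ≠ 0 := (hB_open.measure_pos μ ⟨0, h0U, h0V⟩).ne'
  have hBfin : μ B ≠ ∞ := measure_ne_top_of_subset inter_subset_right hV_fin.ne
  have defect_le {n} (hn : P n) : ∫⁻ a in B, translationDefect μ (E n) a ∂μ ≤ μ B * (η / 3) := by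
    rw [mul_comm, ← setLIntegral_const]
    exact setLIntegral_mono' hB_open.measurableSet fun a ha => small hn (hUQ a ha.1)
  have mass_le := ENNReal.tendsto_nhds_zero.1
    (tendsto_lintegral_edist_localMass hB_open.measurableSet hBfin hΩ hΩfin hE hEΩ weak)
    (μ B * (η / 3)) (by positivity)
  have hPP : ∀ᶠ p : ℕ × ℕ in atTop, P p.1 ∧ P p.2 := by
    rw [← prod_atTop_atTop_eq]
    exact hP.prod_mk hP
  filter_upwards [mass_le, hPP] with p mass_le ⟨hP₁, hP₂⟩
  refine (ENNReal.mul_le_mul_iff_right hB0 hBfin).1 ?_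
  calc μ B * μ (E p.1 ∆ E p.2) ≤ μ B * (η / 3) + μ B * (η / 3) + μ B * (η / 3) :=
        (mul_measure_symmDiff_le hB_open.measurableSet hBfin (hE _) (hE _)).trans
          (add_le_add (add_le_add (defect_le hP₁) (defect_le hP₂)) mass_le)
    _ = μ B * η := by rw [← mul_add, ← mul_add, ENNReal.add_thirds]

theorem exists_subseq_tendsto_measure_symmDiff (hΩ : MeasurableSet Ω) (hΩfin : μ Ω ≠ ∞)
    (hE : ∀ n, MeasurableSet (E n)) (hEΩ : ∀ n, E n ⊆ Ω)
    (hdefect : Tendsto (fun p : ℕ × G => translationDefect μ (E p.1) p.2) (atTop ×ˢ 𝓝 0) (𝓝 0)) :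
    ∃ k : ℕ → ℕ, StrictMono k ∧ ∃ E₀, MeasurableSet E₀ ∧ E₀ ⊆ Ω ∧
      Tendsto (fun j => μ (E (k j) ∆ E₀)) atTop (𝓝 0) := by
  obtain ⟨k, hk, weak⟩ := exists_subseq_forall_tendsto_measureReal_inter hE
    (R := (μ Ω).toNNReal) (fun n => by
      rw [ENNReal.coe_toNNReal hΩfin]
      exact measure_mono (hEΩ n))
  have symmDiff_tendsto := tendsto_measure_symmDiff_of_tendsto_translationDefect hΩ hΩfin
    (fun j => hE (k j)) (fun j => hEΩ (k j))
    (hdefect.comp (hk.tendsto_atTop.prodMap tendsto_id)) weak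
  let u : ℕ → MeasuredSets μ := fun j => ⟨E (k j), hE (k j)⟩
  have cauchy : CauchySeq u := by
    refine EMetric.cauchySeq_iff.2 fun η hη => ?_
    obtain ⟨N, hN⟩ := eventually_atTop_prod_self'.1
      (symmDiff_tendsto.eventually (gt_mem_nhds hη))
    exact ⟨N, hN⟩
  have := completeSpace_measuredSets μ
  obtain ⟨F, limit⟩ := cauchySeq_tendsto_of_complete cauchy
  refine ⟨k, hk, F ∩ Ω, F.2.inter hΩ, inter_subset_right, ?_⟩
  refine tendsto_of_tendsto_of_tendsto_of_le_of_le tendsto_const_nhds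
    (tendsto_iff_edist_tendsto_0.1 limit) (fun _ => zero_le) fun j => measure_mono fun x => ?_
  have := @hEΩ (k j) x
  simp only [u, mem_symmDiff, mem_inter_iff]
  tauto

end TopologicalGroup

end Compactness

theorem tendsto_mul_ofReal_norm_add {V ι : Type*} [SeminormedAddCommGroup V] {l : Filter ι}
    {ε : ι → ℝ} {v : ι → V} {h : V} (hε : Tendsto ε l (𝓝 0)) (hv : Tendsto v l (𝓝 h)) (M : ℝ≥0) :
    Tendsto (fun i => M * ENNReal.ofReal (‖v i‖ + ε i)) l (𝓝 (M * ‖h‖ₑ)) := by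
  refine ENNReal.Tendsto.const_mul ?_ (.inr ENNReal.coe_ne_top)
  rw [← ofReal_norm, ← add_zero ‖h‖]
  exact ENNReal.tendsto_ofReal (hv.norm.add hε)

section FinitePerimeter

theorem integral_translate_sub_mul_le {G : Type*} [AddGroup G] [MeasurableSpace G]
    [MeasurableAdd G] {μ : Measure G} [μ.IsAddRightInvariant] {u ψ : G → ℝ} (hu : Integrable u μ)
    (hψ : Measurable ψ) (hψ_le : ∀ x, |ψ x| ≤ 1) {h : G} {c : ℝ≥0}
    (hc : ∫⁻ x, ‖u x - u (x + h)‖ₑ ∂μ ≤ c) : ∫ x, (ψ (x + h) - ψ x) * u x ∂μ ≤ c := by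
  have hψ_shift : Measurable fun x => ψ (x + h) := hψ.comp (measurable_add_const h)
  have integrable_mul : Integrable (fun x => ψ x * u x) μ :=
    hu.bdd_mul hψ.aestronglyMeasurable (.of_forall hψ_le)
  have integrable_shift_mul : Integrable (fun x => ψ (x + h) * u x) μ :=
    hu.bdd_mul hψ_shift.aestronglyMeasurable (.of_forall fun x => hψ_le _)
  have summation_by_parts : ∫ x, (ψ (x + h) - ψ x) * u x ∂μ =
      ∫ x, ψ (x + h) * (u x - u (x + h)) ∂μ := by
    simp_rw [sub_mul, mul_sub]
    rw [integral_sub integrable_shift_mul integrable_mul,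
      integral_sub integrable_shift_mul (integrable_mul.comp_add_right h),
      integral_add_right_eq_self (fun x => ψ x * u x) h]
  have enorm_le : ‖∫ x, ψ (x + h) * (u x - u (x + h)) ∂μ‖ₑ ≤ c := by
    refine (enorm_integral_le_lintegral_enorm _).trans ((lintegral_mono fun x => ?_).trans hc)
    rw [enorm_mul]
    refine mul_le_of_le_one_left zero_le ?_
    rw [← ofReal_norm, ENNReal.ofReal_le_one]
    exact hψ_le _
  rw [summation_by_parts]
  refine (le_abs_self _).trans ?_
  rw [← Real.norm_eq_abs, ← toReal_enorm]
  exact ENNReal.toReal_le_coe_of_le_coe enorm_le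

theorem integral_lineDeriv_mul_le {V : Type*} [NormedAddCommGroup V] [NormedSpace ℝ V]
    [FiniteDimensional ℝ V] [MeasurableSpace V] [BorelSpace V] {μ : Measure V} [μ.IsAddHaarMeasure]
    {u ψ : V → ℝ} {M : ℝ≥0} (hu : Integrable u μ)
    (hM : ∀ h, ∫⁻ x, ‖u x - u (x + h)‖ₑ ∂μ ≤ M * ‖h‖ₑ) {L : ℝ≥0} (hψ : LipschitzWith L ψ)
    (hψ_le : ∀ x, |ψ x| ≤ 1) (v : V) : ∫ x, lineDeriv ℝ ψ x v * u x ∂μ ≤ M * ‖v‖ := by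
  refine le_of_tendsto (hψ.integral_inv_smul_sub_mul_tendsto_integral_lineDeriv_mul hu v) ?_
  filter_upwards [self_mem_nhdsWithin] with t (ht : 0 < t)
  have difference_le := integral_translate_sub_mul_le hu hψ.continuous.measurable hψ_le
    (c := M * ‖t • v‖₊) (by simpa [enorm_eq_nnnorm] using hM (t • v))
  simp_rw [smul_eq_mul, mul_assoc]
  rw [integral_const_mul, inv_mul_le_iff₀ ht]
  rwa [NNReal.coe_mul, coe_nnnorm, norm_smul, Real.norm_of_nonneg ht.le,
    mul_left_comm] at difference_le

variable {d : ℕ}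

theorem integral_mul_divergence_le {u : Space d → ℝ} {M : ℝ≥0} (hu : Integrable u)
    (hM : ∀ h, ∫⁻ x, ‖u x - u (x + h)‖ₑ ≤ M * ‖h‖ₑ) {φ : Space d → Space d} (hφ : ContDiff ℝ 1 φ)
    (hφ_supp : HasCompactSupport φ) (hφ_le : ∀ x, ‖φ x‖ ≤ 1) :
    ∫ x, u x * divergence φ x ≤ d * M := by
  obtain ⟨L, hL⟩ := hφ.lipschitzWith_of_hasCompactSupport hφ_supp one_ne_zero
  have coord_lipschitz (i : Fin d) : LipschitzWith L fun x => φ x i := .of_dist_le_mul fun x y =>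
    (PiLp.dist_apply_le (φ x) (φ y) i).trans (hL.dist_le_mul x y)
  have lineDeriv_coord (i : Fin d) (x v : Space d) :
      lineDeriv ℝ (fun x => φ x i) x v = (fderiv ℝ φ x v) i :=
    (((EuclideanSpace.proj i : Space d →L[ℝ] ℝ).hasFDerivAt.comp x
      (hφ.differentiable one_ne_zero x).hasFDerivAt).hasLineDerivAt v).lineDeriv
  have integrable_term (i : Fin d) : Integrable fun x =>
      lineDeriv ℝ (fun x => φ x i) x (EuclideanSpace.single i 1) * u x :=
    hu.bdd_mul (measurable_lineDeriv (coord_lipschitz i).continuous).aestronglyMeasurable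
      (.of_forall fun x => norm_lineDeriv_le_of_lipschitz ℝ (coord_lipschitz i))
  calc ∫ x, u x * divergence φ x
      = ∫ x, ∑ i, lineDeriv ℝ (fun x => φ x i) x (EuclideanSpace.single i 1) * u x := by
        simp only [divergence, lineDeriv_coord, Finset.mul_sum, mul_comm]
    _ = ∑ i, ∫ x, lineDeriv ℝ (fun x => φ x i) x (EuclideanSpace.single i 1) * u x :=
        integral_finsetSum _ fun i _ => integrable_term i
    _ ≤ ∑ i : Fin d, (M : ℝ) * ‖EuclideanSpace.single i (1 : ℝ)‖ :=
        Finset.sum_le_sum fun i _ => integral_lineDeriv_mul_le hu hM (coord_lipschitz i)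
          (fun x => (PiLp.norm_apply_le (φ x) i).trans (hφ_le x)) _
    _ = d * M := by simp

theorem divergence_eq_zero_of_notMem_tsupport {φ : Space d → Space d} {x : Space d}
    (hx : x ∉ tsupport φ) : divergence φ x = 0 := by
  have fderiv_eq_zero : fderiv ℝ φ x = 0 :=
    Function.notMem_support.1 fun h => hx (support_fderiv_subset ℝ h)
  simp [divergence, fderiv_eq_zero]

theorem totalVariation_le {u : Space d → ℝ} {M : ℝ≥0} (hu : Integrable u)
    (hM : ∀ h, ∫⁻ x, ‖u x - u (x + h)‖ₑ ≤ M * ‖h‖ₑ) (Ω : Set (Space d)) :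
    totalVariation u Ω ≤ d * M := by
  refine iSup₂_le fun φ ⟨hφ, hφ_supp, hφΩ, hφ_le⟩ => ENNReal.ofReal_le_of_le_toReal ?_
  rw [setIntegral_eq_integral_of_forall_compl_eq_zero fun x hx => by
    rw [divergence_eq_zero_of_notMem_tsupport fun h => hx (hφΩ h), mul_zero]]
  simpa using integral_mul_divergence_le hu hM hφ hφ_supp hφ_le

theorem lintegral_enorm_charFn_sub_le (μ : Measure (Space d)) (E F : Set (Space d)) :
    ∫⁻ x, ‖charFn E x - charFn F x‖ₑ ∂μ ≤ μ (E ∆ F) :=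
  calc ∫⁻ x, ‖charFn E x - charFn F x‖ₑ ∂μ = ∫⁻ x, (E ∆ F).indicator (fun _ => 1) x ∂μ := by
        refine lintegral_congr fun x => ?_
        by_cases hE : x ∈ E <;> by_cases hF : x ∈ F <;> simp [charFn, mem_symmDiff, hE, hF]
    _ ≤ μ (E ∆ F) := (lintegral_indicator_const_le _ _).trans_eq (one_mul _)

theorem hasFinitePerimeter_of_translationDefect_le {E : Set (Space d)} {M : ℝ≥0}
    (hE : NullMeasurableSet E) (hfin : volume E ≠ ∞)
    (hM : ∀ h, translationDefect volume E h ≤ M * ‖h‖ₑ) (Ω : Set (Space d)) :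
    HasFinitePerimeter E Ω := by
  have integrable : Integrable (charFn E) :=
    (integrableOn_const hfin).integrable_indicator₀ hE
  refine ⟨hE, integrable.integrableOn, lt_of_le_of_lt (totalVariation_le (M := M) integrable
    (fun h => ?_) Ω) (by finiteness)⟩
  exact (lintegral_enorm_charFn_sub_le volume E ((· + h) ⁻¹' E)).trans (hM h)

theorem tendstoL1_of_tendsto_volume_symmDiff {E : ℕ → Set (Space d)} {E₀ : Set (Space d)}
    (hE : Tendsto (fun n => volume (E n ∆ E₀)) atTop (𝓝 0)) (Ω : Set (Space d)) :
    TendstoL1 E E₀ Ω := by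
  refine tendsto_of_tendsto_of_tendsto_of_le_of_le tendsto_const_nhds hE (fun _ => zero_le)
    fun n => ?_
  rw [eLpNorm_one_eq_lintegral_enorm]
  exact (lintegral_enorm_charFn_sub_le _ _ _).trans (Measure.restrict_apply_le _ _)

end FinitePerimeter
end NonlocalPerimeter

open NonlocalPerimeter

theorem mainTheorem6_general {d : ℕ} {Ω : Set (Space d)} (hΩ : MeasurableSet Ω)
    (hΩ_fin : volume Ω ≠ ∞) {CΩ : ℝ≥0}
    (hΩ_le : ∀ h, translationDefect volume Ω h ≤ CΩ * ‖h‖ₑ) {K : Space d → ℝ}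
    (hK_meas : AEMeasurable K) (hK_nonneg : 0 ≤ᵐ[volume] K) (hK_ne : ¬ K =ᵐ[volume] 0)
    {ε : ℕ → ℝ} (hε_pos : ∀ n, 0 < ε n) (hε_lim : Tendsto ε atTop (𝓝 0)) {E : ℕ → Set (Space d)}
    (hE_meas : ∀ n, NullMeasurableSet (E n)) (hE_sub : ∀ n, E n ⊆ Ω) {C : ℝ≥0}
    (hE_bdd : ∀ n, ENNReal.ofReal (1 / ε n) *
      localEnergy (rescale K (ε n)) (charFn (E n)) Ω ≤ C) :
    ∃ k : ℕ → ℕ, StrictMono k ∧ ∃ E₀ : Set (Space d),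
      HasFinitePerimeter E₀ Ω ∧ TendstoL1 (fun j => E (k j)) E₀ Ω := by
  obtain ⟨δ, hδ, A, hA, hA0, hKA⟩ := exists_isCompact_forall_le_of_not_ae_le_zero hK_meas
    fun hK_nonpos => hK_ne (hK_nonpos.antisymm hK_nonneg)
  obtain ⟨M, hM⟩ := exists_forall_translationDefect_le (C := C) hΩ hΩ_le hA hA0 hδ hKA
  choose F hFE hF hF_ae using fun n => (hE_meas n).exists_measurable_subset_ae_eq
  have hFΩ (n) : F n ⊆ Ω := (hFE n).trans (hE_sub n)
  have energy_eq (n) : ENNReal.ofReal (1 / ε n) *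
      localEnergy (rescale K (ε n)) (charFn (F n)) Ω = ENNReal.ofReal (1 / ε n) *
        localEnergy (rescale K (ε n)) (charFn (E n)) Ω :=
    congrArg _ (localEnergy_congr_ae _ (indicator_ae_eq_of_ae_eq_set (hF_ae n)) Ω)
  have defect_le (n h) : translationDefect volume (F n) h ≤ M * ENNReal.ofReal (‖h‖ + ε n) :=
    hM (ε n) (hε_pos n) (F n) (hFΩ n) (hF n) ((energy_eq n).trans_le (hE_bdd n)) h
  have defect_tendsto : Tendsto (fun p : ℕ × Space d => translationDefect volume (F p.1) p.2)
      (atTop ×ˢ 𝓝 0) (𝓝 0) := by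
    refine tendsto_of_tendsto_of_tendsto_of_le_of_le tendsto_const_nhds ?_ (fun _ => zero_le)
      fun p => defect_le p.1 p.2
    simpa using tendsto_mul_ofReal_norm_add (hε_lim.comp tendsto_fst)
      (tendsto_snd (f := atTop) (g := 𝓝 (0 : Space d))) M
  obtain ⟨k, hk, E₀, hE₀, hE₀Ω, limit⟩ :=
    exists_subseq_tendsto_measure_symmDiff hΩ hΩ_fin hF hFΩ defect_tendsto
  have limit_defect_le (h) : translationDefect volume E₀ h ≤ M * ‖h‖ₑ :=
    translationDefect_le_of_tendsto (fun j => defect_le (k j) h)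
      (tendsto_mul_ofReal_norm_add (hε_lim.comp hk.tendsto_atTop) tendsto_const_nhds M) limit
  refine ⟨k, hk, E₀, hasFinitePerimeter_of_translationDefect_le hE₀.nullMeasurableSet
    (measure_ne_top_of_subset hE₀Ω hΩ_fin) limit_defect_le Ω, ?_⟩
  exact tendstoL1_of_tendsto_volume_symmDiff
    (limit.congr fun j => measure_congr ((hF_ae (k j)).symmDiff .rfl)) Ω

theorem mainTheorem6 (d : ℕ) (hd : 1 ≤ d)
    (Ω : Set (NonlocalPerimeter.Space d)) (hΩ_open : IsOpen Ω) (hΩ_conn : IsConnected Ω)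
    (hΩ_bdd : Bornology.IsBounded Ω) (hΩ_lip : NonlocalPerimeter.HasLipschitzBoundary Ω)
    (Kbar : ℝ → ℝ) (hK_nonneg : ∀ r, 0 ≤ r → 0 ≤ Kbar r)
    (hK_meas : AEMeasurable Kbar (volume.restrict (Ici 0)))
    (hK_int : ∫⁻ r in Ici (0 : ℝ), ENNReal.ofReal (Kbar r * r ^ d) < ∞)
    (hK_ne : ¬ NonlocalPerimeter.radialKernel d Kbar =ᵐ[volume] 0)
    (ε : ℕ → ℝ) (hε_pos : ∀ n, 0 < ε n) (hε_lim : Tendsto ε atTop (𝓝 0))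
    (E : ℕ → Set (NonlocalPerimeter.Space d))
    (hE_meas : ∀ n, NullMeasurableSet (E n) volume) (hE_sub : ∀ n, E n ⊆ Ω)
    (C : ℝ≥0)
    (hE_bdd : ∀ n, ENNReal.ofReal (1 / ε n) *
      NonlocalPerimeter.localEnergy
        (NonlocalPerimeter.rescale (NonlocalPerimeter.radialKernel d Kbar) (ε n))
        (NonlocalPerimeter.charFn (E n)) Ω ≤ C) :
    ∃ k : ℕ → ℕ, StrictMono k ∧ ∃ E₀ : Set (NonlocalPerimeter.Space d),
      NonlocalPerimeter.HasFinitePerimeter E₀ Ω ∧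
        NonlocalPerimeter.TendstoL1 (fun j => E (k j)) E₀ Ω := by
  obtain ⟨CΩ, hΩ_le⟩ := hΩ_lip.exists_translationDefect_le hΩ_bdd
  exact mainTheorem6_general hΩ_open.measurableSet hΩ_bdd.measure_lt_top.ne hΩ_le
    (aemeasurable_radialKernel hd hK_meas) (.of_forall fun h => hK_nonneg _ (norm_nonneg h)) hK_ne
    hε_pos hε_lim hE_meas hE_sub hE_bdd
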